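/- For $(\tau,\sigma)\in\mathbb R^2$ and $f\in L^2(\mathbb R)$ let $\rho(\tau,\sigma)f(t)=e^{\pi i\tau\sigma}e^{2\pi i\sigma t}f(t+\tau)$. Fix a window $\phi\in L^2(\mathbb R)$ with $\|\phi\|=1$ and let $$\mathcal S_\phi f(\tau,\sigma)=\langle f,\rho(\tau,\sigma)\phi\rangle=\int_{\mathbb R} f(t)\,\overline{\rho(\tau,\sigma)\phi(t)}\,dt .$$ For a bounded measurable set $\Omega\subset\mathbb R^2$ let $\mathcal C_\Omega:L^2(\mathbb R)\to L^2(\mathbb R)$ be the concentration operator, that is, the unique bounded operator with $$\langle \mathcal C_\Omega f,g\rangle=\iint_\Omega \langle f,\rho(\tau,\sigma)\phi\rangle\,\langle\rho(\tau,\sigma)\phi,g\rangle\,d\tau\,d\sigma\qquad\text{for all } f,g\in L^2(\mathbb R),$$ and for $r>0$ let $\Omega_r=\{(r\tau,r\sigma):(\tau,\sigma)\in\Omega\}$. **Theorem.** Let $\Omega\subset\mathbb R^2$ be a bounded domain (nonempty connected open set) with $C^1$ boundary, and let $0<\lambda<\mu<1$. Assume that there are constants $p,A>0$ such that $$\Bigl|1-\iint_{B_r}|\mathcal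 S_\phi\phi(\tau,\sigma)|^2\,d\tau\,d\sigma\Bigr|\le \frac{A}{r^p}\qquad\text{for all } r>0,$$ where $B_r$ is the Euclidean disc of radius $r$ centred at the origin. Then there is a constant $C>0$ (depending only on $\phi,\Omega,\lambda,\mu$) such that for every $r>0$ the number $n(\lambda,\mu,\Omega_r)$ of eigenvalues of $\mathcal C_{\Omega_r}$ lying in $[\lambda,\mu]$, counted with multiplicity, satisfies $$n(\lambda,\mu,\Omega_r)\le C\,r .$$ -/

import Mathlib

open MeasureTheory Set

noncomputable section

namespace Gabor

/-- The Hilbert space of square integrable complex functions on the real line. -/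
abbrev L2 : Type := Lp ℂ 2 (volume : Measure ℝ)

/-- The time-frequency shift `exp(π i τ σ) exp(2 π i σ t) f(t + τ)`, with `z = (τ, σ)`,
of a function. -/
def shiftFun (z : ℝ × ℝ) (f : ℝ → ℂ) (t : ℝ) : ℂ :=
  Complex.exp (Real.pi * Complex.I * z.1 * z.2) *
    Complex.exp (2 * Real.pi * Complex.I * z.2 * t) * f (t + z.1)

theorem norm_phase (z : ℝ × ℝ) (t : ℝ) :
    ‖Complex.exp (Real.pi * Complex.I * z.1 * z.2) *
      Complex.exp (2 * Real.pi * Complex.I * z.2 * t)‖ = 1 := by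
  have h1 : (Real.pi * Complex.I * z.1 * z.2 : ℂ) = ((Real.pi * z.1 * z.2 : ℝ) : ℂ) * Complex.I := by
    push_cast; ring
  have h2 : (2 * Real.pi * Complex.I * z.2 * t : ℂ)
      = ((2 * Real.pi * z.2 * t : ℝ) : ℂ) * Complex.I := by
    push_cast; ring
  rw [h1, h2, norm_mul, Complex.norm_exp_ofReal_mul_I, Complex.norm_exp_ofReal_mul_I, one_mul]

theorem memLp_shiftFun (z : ℝ × ℝ) (f : L2) : MemLp (shiftFun z f) 2 volume := by
  have h : MemLp (fun t => f (t + z.1)) 2 volume :=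
    (Lp.memLp f).comp_measurePreserving (measurePreserving_add_right volume z.1)
  refine h.of_le ?_ (Filter.Eventually.of_forall fun t => ?_)
  · refine AEStronglyMeasurable.mul ?_ h.1
    exact Continuous.aestronglyMeasurable (by fun_prop)
  · rw [shiftFun, norm_mul, norm_phase, one_mul]

/-- The time-frequency shift `ρ(τ, σ)` on `L²(ℝ)`, with `z = (τ, σ)`. -/
def shift (z : ℝ × ℝ) (f : L2) : L2 := (memLp_shiftFun z f).toLp (shiftFun z f)

/-- The Gabor transform `S_φ f (z) = ⟨f, ρ(z) φ⟩ = ∫ f(t) conj(ρ(z) φ(t)) dt`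
(Mathlib's inner product is linear in the second argument). -/
def gabor (φ f : L2) (z : ℝ × ℝ) : ℂ := inner ℂ (shift z φ) f

/-- The form `E_Ω(f, g) = ∫∫_Ω ⟨f, ρ(z) φ⟩ ⟨ρ(z) φ, g⟩ dz`. -/
def energyForm (φ : L2) (Ω : Set (ℝ × ℝ)) (f g : L2) : ℂ :=
  ∫ z in Ω, gabor φ f z * inner ℂ g (shift z φ)

open Classical in
/-- The concentration operator `C_Ω`: the bounded operator on `L²(ℝ)` with
`⟨C_Ω f, g⟩ = E_Ω(f, g)` for all `f, g`. It is unique; see `inner_concentrationOp` for its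
existence when `Ω` has finite measure. -/
def concentrationOp (φ : L2) (Ω : Set (ℝ × ℝ)) : L2 →L[ℂ] L2 :=
  if h : ∃ T : L2 →L[ℂ] L2, ∀ f g, inner ℂ g (T f) = energyForm φ Ω f g then h.choose else 0

theorem gabor_eq_integral (φ f : L2) (z : ℝ × ℝ) :
    gabor φ f z = ∫ t, f t * (starRingEnd ℂ) (shiftFun z φ t) := by
  rw [gabor, L2.inner_def]
  refine integral_congr_ae ?_
  filter_upwards [(memLp_shiftFun z φ).coeFn_toLp] with t ht
  rw [shift, ht]
  simp

theorem norm_shift (z : ℝ × ℝ) (f : L2) : ‖shift z f‖ = ‖f‖ := by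
  rw [shift, Lp.norm_toLp, Lp.norm_def]
  congr 1
  have h1 : eLpNorm (shiftFun z f) 2 volume = eLpNorm (fun t => f (t + z.1)) 2 volume := by
    refine eLpNorm_congr_norm_ae (Filter.Eventually.of_forall fun t => ?_)
    rw [shiftFun, norm_mul, norm_phase, one_mul]
  rw [h1]
  exact eLpNorm_comp_measurePreserving (Lp.aestronglyMeasurable f)
    (measurePreserving_add_right volume z.1)

theorem norm_gabor_le (φ f : L2) (z : ℝ × ℝ) : ‖gabor φ f z‖ ≤ ‖φ‖ * ‖f‖ := by
  have := norm_inner_le_norm (𝕜 := ℂ) (shift z φ) f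
  rwa [norm_shift] at this

theorem stronglyMeasurable_gabor (φ f : L2) : StronglyMeasurable (gabor φ f) := by
  have h : gabor φ f = fun z => ∫ t, f t * (starRingEnd ℂ) (shiftFun z φ t) :=
    funext (gabor_eq_integral φ f)
  rw [h]
  have hf : Measurable (f : ℝ → ℂ) := (Lp.stronglyMeasurable f).measurable
  have hφ : Measurable (φ : ℝ → ℂ) := (Lp.stronglyMeasurable φ).measurable
  have hm : Measurable (fun p : (ℝ × ℝ) × ℝ => f p.2 * (starRingEnd ℂ) (shiftFun p.1 φ p.2)) := by
    refine (hf.comp measurable_snd).mul (Complex.continuous_conj.measurable.comp ?_)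
    unfold shiftFun
    refine Measurable.mul ?_ (hφ.comp (by fun_prop))
    exact Continuous.measurable (by fun_prop)
  exact hm.stronglyMeasurable.integral_prod_right (ν := (volume : Measure ℝ))

theorem inner_shift_eq (φ g : L2) (z : ℝ × ℝ) :
    inner ℂ g (shift z φ) = (starRingEnd ℂ) (gabor φ g z) := by
  rw [gabor, inner_conj_symm]

theorem integrableOn_energy (φ : L2) (Ω : Set (ℝ × ℝ)) (hΩ : volume Ω ≠ ⊤) (f g : L2) :
    IntegrableOn (fun z => gabor φ f z * inner ℂ g (shift z φ)) Ω := by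
  refine IntegrableOn.of_bound hΩ.lt_top ?_ ((‖φ‖ * ‖f‖) * (‖φ‖ * ‖g‖))
    (Filter.Eventually.of_forall fun z => ?_)
  · simp only [inner_shift_eq]
    exact ((stronglyMeasurable_gabor φ f).mul
      (Complex.continuous_conj.comp_stronglyMeasurable
        (stronglyMeasurable_gabor φ g))).aestronglyMeasurable
  · rw [norm_mul, inner_shift_eq, RCLike.norm_conj]
    exact mul_le_mul (norm_gabor_le φ f z) (norm_gabor_le φ g z) (norm_nonneg _) (by positivity)

theorem exists_concentrationOp (φ : L2) (Ω : Set (ℝ × ℝ)) (hΩ : volume Ω ≠ ⊤) :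
    ∃ T : L2 →L[ℂ] L2, ∀ f g, inner ℂ g (T f) = energyForm φ Ω f g := by
  have hi := integrableOn_energy φ Ω hΩ
  let B : L2 →ₗ⋆[ℂ] L2 →ₗ[ℂ] ℂ := LinearMap.mk₂'ₛₗ (starRingEnd ℂ) (RingHom.id ℂ)
    (fun g f => energyForm φ Ω f g)
    (fun g g' f => by
      simp only [energyForm, inner_add_left, mul_add]
      exact integral_add (hi f g) (hi f g'))
    (fun c g f => by
      simp only [energyForm, inner_smul_left, smul_eq_mul]
      rw [← integral_const_mul]
      congr 1; ext z; ring)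
    (fun g f f' => by
      simp only [energyForm, gabor, inner_add_right, add_mul]
      exact integral_add (hi f g) (hi f' g))
    (fun c g f => by
      simp only [energyForm, gabor, inner_smul_right, smul_eq_mul, RingHom.id_apply]
      rw [← integral_const_mul]
      congr 1; ext z; ring)
  let A : L2 →L⋆[ℂ] L2 →L[ℂ] ℂ := B.mkContinuous₂ (‖φ‖ ^ 2 * volume.real Ω) (fun g f => by
    have h := norm_setIntegral_le_of_norm_le_const (μ := (volume : Measure (ℝ × ℝ)))
      (f := fun z => gabor φ f z * inner ℂ g (shift z φ)) (C := (‖φ‖ * ‖f‖) * (‖φ‖ * ‖g‖))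
      hΩ.lt_top (fun z _ => by
        rw [norm_mul, inner_shift_eq, RCLike.norm_conj]
        exact mul_le_mul (norm_gabor_le φ f z) (norm_gabor_le φ g z) (norm_nonneg _)
          (by positivity))
    calc ‖B g f‖ ≤ (‖φ‖ * ‖f‖) * (‖φ‖ * ‖g‖) * volume.real Ω := h
      _ = _ := by ring)
  refine ⟨ContinuousLinearMap.adjoint (InnerProductSpace.continuousLinearMapOfBilin A),
    fun f g => ?_⟩
  rw [ContinuousLinearMap.adjoint_inner_right,
    InnerProductSpace.continuousLinearMapOfBilin_apply]
  rfl

theorem inner_concentrationOp (φ : L2) (Ω : Set (ℝ × ℝ)) (hΩ : volume Ω ≠ ⊤) (f g : L2) :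
    inner ℂ g (concentrationOp φ Ω f) = energyForm φ Ω f g := by
  rw [concentrationOp, dif_pos (exists_concentrationOp φ Ω hΩ)]
  exact (exists_concentrationOp φ Ω hΩ).choose_spec f g

/-- The number of eigenvalues of `T` in `[a, b]`, counted with multiplicity: the sum over
`ν ∈ [a, b]` of the dimension of `ker (T - ν)`, as an element of `[0, ∞]`. -/
def eigenvalueCount (T : L2 →L[ℂ] L2) (a b : ℝ) : ENNReal :=
  ∑' ν : Icc a b,
    ((Cardinal.toENat
      (Module.rank ℂ (Module.End.eigenspace (T : L2 →ₗ[ℂ] L2) ((ν : ℝ) : ℂ))) : ℕ∞) : ENNReal)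

/-- The dilated region `Ω_r = {(r τ, r σ) : (τ, σ) ∈ Ω}`. -/
def dilate (r : ℝ) (Ω : Set (ℝ × ℝ)) : Set (ℝ × ℝ) := (fun z => (r * z.1, r * z.2)) '' Ω

/-- The Euclidean disc of radius `r` about the origin of the time-frequency plane. -/
def disc (r : ℝ) : Set (ℝ × ℝ) := {z | z.1 ^ 2 + z.2 ^ 2 < r ^ 2}

/-- A bounded plane domain with `C¹` boundary: a nonempty bounded connected open set which, near
each of its boundary points, is the set where a `C¹` function with nonvanishing differential is
negative. -/
structure IsBoundedC1Domain (Ω : Set (ℝ × ℝ)) : Prop where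
  isOpen : IsOpen Ω
  isConnected : IsConnected Ω
  isBounded : Bornology.IsBounded Ω
  boundary : ∀ x ∈ frontier Ω, ∃ U : Set (ℝ × ℝ), ∃ g : ℝ × ℝ → ℝ,
    IsOpen U ∧ x ∈ U ∧ ContDiffOn ℝ 1 g U ∧ (∀ y ∈ U, fderiv ℝ g y ≠ 0) ∧
      Ω ∩ U = {y ∈ U | g y < 0}

/-- The decay condition `|1 - ∫_{B_r} f| ≤ C / r ^ p` for all `r > 0`, with some constants
`p, C > 0`. -/
def TailDecay (f : ℝ × ℝ → ℝ) : Prop :=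
  ∃ p C : ℝ, 0 < p ∧ 0 < C ∧ ∀ r : ℝ, 0 < r → |1 - ∫ z in disc r, f z| ≤ C / r ^ p

end Gabor

end

noncomputable section

namespace Gabor

open Filter Topology
open scoped ContDiff FourierTransform ENNReal Pointwise

theorem shift_add (z : ℝ × ℝ) (f g : L2) : shift z (f + g) = shift z f + shift z g := by
  rw [shift, shift, shift, ← MemLp.toLp_add, MemLp.toLp_eq_toLp_iff]
  filter_upwards [(quasiMeasurePreserving_add_right volume z.1).ae (Lp.coeFn_add f g)] with t ht
  simp only [shiftFun, Pi.add_apply] at ht ⊢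
  rw [ht]; ring

theorem shift_smul (z : ℝ × ℝ) (c : ℂ) (f : L2) : shift z (c • f) = c • shift z f := by
  rw [shift, shift, ← MemLp.toLp_const_smul, MemLp.toLp_eq_toLp_iff]
  filter_upwards [(quasiMeasurePreserving_add_right volume z.1).ae (Lp.coeFn_smul c f)] with t ht
  simp only [shiftFun, Pi.smul_apply, smul_eq_mul] at ht ⊢
  rw [ht]; ring

theorem gabor_add_left (φ ψ f : L2) (z : ℝ × ℝ) :
    gabor (φ + ψ) f z = gabor φ f z + gabor ψ f z := by
  simp [gabor, shift_add, inner_add_left]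

theorem gabor_smul_left (c : ℂ) (φ f : L2) (z : ℝ × ℝ) :
    gabor (c • φ) f z = (starRingEnd ℂ) c * gabor φ f z := by
  simp [gabor, shift_smul, inner_smul_left]

theorem gabor_add_right (φ f g : L2) (z : ℝ × ℝ) :
    gabor φ (f + g) z = gabor φ f z + gabor φ g z := by
  simp [gabor, inner_add_right]

theorem gabor_smul_right (c : ℂ) (φ f : L2) (z : ℝ × ℝ) :
    gabor φ (c • f) z = c * gabor φ f z := by
  simp [gabor, inner_smul_right]

theorem gabor_sub_left (φ ψ f : L2) (z : ℝ × ℝ) :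
    gabor (φ - ψ) f z = gabor φ f z - gabor ψ f z := by
  rw [eq_sub_iff_add_eq, ← gabor_add_left, sub_add_cancel]

/-- The Gabor transform is, up to a phase, a windowed Fourier transform. -/
theorem norm_gabor_eq_norm_fourier {φ f : L2} {p g : ℝ → ℂ} (hp : φ =ᵐ[volume] p)
    (hg : f =ᵐ[volume] g) (z : ℝ × ℝ) :
    ‖gabor φ f z‖ = ‖𝓕 (fun t => g t * (starRingEnd ℂ) (p (t + z.1))) z.2‖ := by
  have h : gabor φ f z = Complex.exp (((-(Real.pi * z.1 * z.2) : ℝ) : ℂ) * Complex.I) *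
      𝓕 (fun t => g t * (starRingEnd ℂ) (p (t + z.1))) z.2 := by
    rw [gabor_eq_integral, Real.fourier_real_eq, ← integral_const_mul]
    refine integral_congr_ae ?_
    filter_upwards [(quasiMeasurePreserving_add_right volume z.1).ae hp, hg] with t h1 h2
    rw [h2, shiftFun, h1, Circle.smul_def, Real.fourierChar_apply, smul_eq_mul]
    simp only [map_mul, ← Complex.exp_conj, Complex.conj_ofReal, Complex.conj_I, map_ofNat]
    rw [show (Real.pi * -Complex.I * z.1 * z.2 : ℂ)
      = ((-(Real.pi * z.1 * z.2) : ℝ) : ℂ) * Complex.I by push_cast; ring,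
      show (2 * Real.pi * -Complex.I * z.2 * t : ℂ)
      = ((2 * Real.pi * -(t * z.2) : ℝ) : ℂ) * Complex.I by push_cast; ring]
    ring
  rw [h, norm_mul, Complex.norm_exp_ofReal_mul_I, one_mul]

/-- The classes in `L²(ℝ)` of smooth functions with compact support. -/
def testClasses : Set L2 :=
  {f | ∃ g : ℝ → ℂ, f =ᵐ[volume] g ∧ HasCompactSupport g ∧ ContDiff ℝ ∞ g}

theorem dense_testClasses : Dense testClasses :=
  Lp.dense_hasCompactSupport_contDiff (by simp)

theorem enorm_sq_eq_lintegral {α : Type*} [MeasurableSpace α] {μ : Measure α} (f : Lp ℂ 2 μ) :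
    ‖f‖ₑ ^ 2 = ∫⁻ t, ‖f t‖ₑ ^ 2 ∂μ := by
  rw [Lp.enorm_def, eLpNorm_eq_lintegral_rpow_enorm_toReal (by simp) (by simp), ← ENNReal.rpow_natCast,
    ← ENNReal.rpow_mul]
  simp

theorem enorm_sq_eq_lintegral_of_ae_eq {α : Type*} [MeasurableSpace α] {μ : Measure α}
    {f : Lp ℂ 2 μ} {g : α → ℂ} (h : f =ᵐ[μ] g) : ‖f‖ₑ ^ 2 = ∫⁻ t, ‖g t‖ₑ ^ 2 ∂μ := by
  rw [enorm_sq_eq_lintegral]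
  refine lintegral_congr_ae ?_
  filter_upwards [h] with t ht
  rw [ht]

theorem lintegral_fourier_sq {g : ℝ → ℂ} (h1 : HasCompactSupport g) (h2 : ContDiff ℝ ∞ g) :
    ∫⁻ s, ‖𝓕 g s‖ₑ ^ 2 = ∫⁻ t, ‖g t‖ₑ ^ 2 := by
  have key := SchwartzMap.norm_fourier_toL2_eq (h1.toSchwartzMap h2)
  have h3 := enorm_sq_eq_lintegral_of_ae_eq ((𝓕 (h1.toSchwartzMap h2)).coeFn_toLp 2 volume)
  have h4 := enorm_sq_eq_lintegral_of_ae_eq ((h1.toSchwartzMap h2).coeFn_toLp 2 volume)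
  have h5 : ‖(𝓕 (h1.toSchwartzMap h2)).toLp 2 volume‖ₑ = ‖(h1.toSchwartzMap h2).toLp 2 volume‖ₑ := by
    rw [← ofReal_norm, ← ofReal_norm, key]
  rw [h5, h4] at h3
  exact h3.symm

theorem measurable_enorm_gabor_sq (φ f : L2) : Measurable fun z => ‖gabor φ f z‖ₑ ^ 2 :=
  (stronglyMeasurable_gabor φ f).measurable.enorm.pow_const 2

theorem lintegral_gabor_sq_of_testClasses {φ f : L2} (hφ : φ ∈ testClasses)
    (hf : f ∈ testClasses) : ∫⁻ z, ‖gabor φ f z‖ₑ ^ 2 = ‖φ‖ₑ ^ 2 * ‖f‖ₑ ^ 2 := by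
  obtain ⟨p, hp, hp1, hp2⟩ := hφ
  obtain ⟨g, hg, hg1, hg2⟩ := hf
  have hz : ∀ z, ‖gabor φ f z‖ₑ ^ 2
      = ‖𝓕 (fun t => g t * (starRingEnd ℂ) (p (t + z.1))) z.2‖ₑ ^ 2 := fun z => by
    rw [← ofReal_norm, norm_gabor_eq_norm_fourier hp hg, ofReal_norm]
  rw [Measure.volume_eq_prod, lintegral_prod _ (measurable_enorm_gabor_sq φ f).aemeasurable]
  have h1 : ∀ τ : ℝ, ∫⁻ s, ‖gabor φ f (τ, s)‖ₑ ^ 2 = ∫⁻ t, ‖g t‖ₑ ^ 2 * ‖p (t + τ)‖ₑ ^ 2 := by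
    intro τ
    simp only [hz]
    rw [lintegral_fourier_sq (g := fun t => g t * (starRingEnd ℂ) (p (t + τ)))]
    · simp [mul_pow]
    · exact hg1.mul_right
    · exact hg2.mul (Complex.conjCLE.contDiff.comp (hp2.comp (by fun_prop)))
  simp only [h1]
  have hgm := hg2.continuous.measurable
  have hpm := hp2.continuous.measurable
  rw [lintegral_lintegral_swap (by fun_prop)]
  have h2 : ∀ t : ℝ, ∫⁻ τ, ‖g t‖ₑ ^ 2 * ‖p (t + τ)‖ₑ ^ 2 = ‖g t‖ₑ ^ 2 * ‖φ‖ₑ ^ 2 := by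
    intro t
    rw [lintegral_const_mul _ (by fun_prop), enorm_sq_eq_lintegral_of_ae_eq hp,
      lintegral_add_left_eq_self (fun x => ‖p x‖ₑ ^ 2) t]
  simp only [h2]
  rw [lintegral_mul_const _ (by fun_prop), ← enorm_sq_eq_lintegral_of_ae_eq hg, mul_comm]

theorem continuous_gabor_right (φ : L2) (z : ℝ × ℝ) : Continuous fun f => gabor φ f z := by
  unfold gabor; fun_prop

theorem continuous_gabor_left (f : L2) (z : ℝ × ℝ) : Continuous fun φ => gabor φ f z := by
  refine (LipschitzWith.of_dist_le_mul (K := ‖f‖₊) fun φ ψ => ?_).continuous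
  rw [dist_eq_norm, dist_eq_norm, ← gabor_sub_left, mul_comm]
  exact norm_gabor_le _ _ _

theorem isClosed_lintegral_gabor_sq_le {X : Type*} [TopologicalSpace X] [FirstCountableTopology X]
    (a b : X → L2) (ha : Continuous a) (hb : Continuous b)
    (h : ∀ z, Continuous fun x => gabor (a x) (b x) z) :
    IsClosed {x | ∫⁻ z, ‖gabor (a x) (b x) z‖ₑ ^ 2 ≤ ‖a x‖ₑ ^ 2 * ‖b x‖ₑ ^ 2} := by
  refine IsSeqClosed.isClosed fun u x hu hx => ?_
  have hlim : ∀ z, Tendsto (fun n => ‖gabor (a (u n)) (b (u n)) z‖ₑ ^ 2) atTop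
      (𝓝 (‖gabor (a x) (b x) z‖ₑ ^ 2)) := fun z =>
    ((ENNReal.continuous_pow 2).comp (h z).enorm).continuousAt.tendsto.comp hx
  have hbd : Tendsto (fun n => ‖a (u n)‖ₑ ^ 2 * ‖b (u n)‖ₑ ^ 2) atTop
      (𝓝 (‖a x‖ₑ ^ 2 * ‖b x‖ₑ ^ 2)) := by
    refine ENNReal.Tendsto.mul ?_ (Or.inr (by simp)) ?_ (Or.inr (by simp))
    · exact ((ENNReal.continuous_pow 2).comp ha.enorm).continuousAt.tendsto.comp hx
    · exact ((ENNReal.continuous_pow 2).comp hb.enorm).continuousAt.tendsto.comp hx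
  calc ∫⁻ z, ‖gabor (a x) (b x) z‖ₑ ^ 2
      = ∫⁻ z, liminf (fun n => ‖gabor (a (u n)) (b (u n)) z‖ₑ ^ 2) atTop :=
        lintegral_congr fun z => (hlim z).liminf_eq.symm
    _ ≤ liminf (fun n => ∫⁻ z, ‖gabor (a (u n)) (b (u n)) z‖ₑ ^ 2) atTop :=
        lintegral_liminf_le fun n => measurable_enorm_gabor_sq _ _
    _ ≤ liminf (fun n => ‖a (u n)‖ₑ ^ 2 * ‖b (u n)‖ₑ ^ 2) atTop :=
        liminf_le_liminf (Eventually.of_forall hu)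
    _ = _ := hbd.liminf_eq

theorem lintegral_gabor_sq_le (φ f : L2) :
    ∫⁻ z, ‖gabor φ f z‖ₑ ^ 2 ≤ ‖φ‖ₑ ^ 2 * ‖f‖ₑ ^ 2 := by
  have h1 : ∀ φ ∈ testClasses, ∀ f, ∫⁻ z, ‖gabor φ f z‖ₑ ^ 2 ≤ ‖φ‖ₑ ^ 2 * ‖f‖ₑ ^ 2 := by
    intro φ hφ
    have hc := isClosed_lintegral_gabor_sq_le (fun _ => φ) (fun f => f) continuous_const
      continuous_id (continuous_gabor_right φ)
    exact fun f => hc.closure_subset_iff.2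
      (fun f hf => (lintegral_gabor_sq_of_testClasses hφ hf).le) (dense_testClasses f)
  have hc := isClosed_lintegral_gabor_sq_le (fun φ => φ) (fun _ => f) continuous_id
    continuous_const (continuous_gabor_left f)
  exact hc.closure_subset_iff.2 (fun φ hφ => h1 φ hφ f) (dense_testClasses φ)

theorem memLp_gabor (φ f : L2) : MemLp (gabor φ f) 2 volume := by
  refine ⟨(stronglyMeasurable_gabor φ f).aestronglyMeasurable, ?_⟩
  rw [eLpNorm_eq_lintegral_rpow_enorm_toReal (by simp) (by simp)]
  refine ENNReal.rpow_lt_top_of_nonneg (by simp) (ne_top_of_le_ne_top ?_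
    (by simpa using lintegral_gabor_sq_le φ f))
  exact ENNReal.mul_ne_top (by simp) (by simp)

/-- The Hilbert space of square integrable functions on the time-frequency plane. -/
abbrev PhaseL2 : Type := Lp ℂ 2 (volume : Measure (ℝ × ℝ))

/-- The Gabor transform as an element of `L²(ℝ²)`. -/
def gaborLp (φ f : L2) : PhaseL2 := (memLp_gabor φ f).toLp (gabor φ f)

theorem coeFn_gaborLp (φ f : L2) : gaborLp φ f =ᵐ[volume] gabor φ f := (memLp_gabor φ f).coeFn_toLp

theorem enorm_gaborLp_sq (φ f : L2) : ‖gaborLp φ f‖ₑ ^ 2 = ∫⁻ z, ‖gabor φ f z‖ₑ ^ 2 :=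
  enorm_sq_eq_lintegral_of_ae_eq (coeFn_gaborLp φ f)

theorem norm_gaborLp_le (φ f : L2) : ‖gaborLp φ f‖ ≤ ‖φ‖ * ‖f‖ := by
  have h := lintegral_gabor_sq_le φ f
  rw [← enorm_gaborLp_sq, ← mul_pow] at h
  rw [ENNReal.pow_le_pow_left_iff (by norm_num), ← ofReal_norm, ← ofReal_norm, ← ofReal_norm,
    ← ENNReal.ofReal_mul (norm_nonneg _), ENNReal.ofReal_le_ofReal_iff (by positivity)] at h
  exact h

/-- The Gabor transform as a bounded sesquilinear map of the window and the signal. -/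
def gaborL : L2 →L⋆[ℂ] L2 →L[ℂ] PhaseL2 :=
  (LinearMap.mk₂'ₛₗ (starRingEnd ℂ) (RingHom.id ℂ) gaborLp
    (fun φ ψ f => by
      rw [gaborLp, gaborLp, gaborLp, ← MemLp.toLp_add]
      congr 1; ext z; exact gabor_add_left φ ψ f z)
    (fun c φ f => by
      rw [gaborLp, gaborLp, ← MemLp.toLp_const_smul]
      congr 1; ext z; exact gabor_smul_left c φ f z)
    (fun φ f g => by
      rw [gaborLp, gaborLp, gaborLp, ← MemLp.toLp_add]
      congr 1; ext z; exact gabor_add_right φ f g z)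
    (fun c φ f => by
      rw [gaborLp, gaborLp, RingHom.id_apply, ← MemLp.toLp_const_smul]
      congr 1; ext z; exact gabor_smul_right c φ f z)).mkContinuous₂ 1 fun φ f => by
    simpa using norm_gaborLp_le φ f

theorem gaborL_apply (φ f : L2) : gaborL φ f = gaborLp φ f := rfl

theorem norm_gaborL_le (φ : L2) : ‖gaborL φ‖ ≤ ‖φ‖ :=
  ContinuousLinearMap.opNorm_le_bound _ (norm_nonneg _) (norm_gaborLp_le φ)

/-- Moyal's identity. -/
theorem norm_gaborL_apply (φ f : L2) : ‖gaborL φ f‖ = ‖φ‖ * ‖f‖ := by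
  have h0 : ∀ φ ∈ testClasses, ∀ f ∈ testClasses, ‖gaborL φ f‖ = ‖φ‖ * ‖f‖ := by
    intro φ hφ f hf
    have h := lintegral_gabor_sq_of_testClasses hφ hf
    rw [← enorm_gaborLp_sq, ← mul_pow] at h
    have h' := (ENNReal.pow_right_strictMono (n := 2) (by norm_num)).injective h
    rw [gaborL_apply]
    simpa using congrArg ENNReal.toReal h'
  have h1 : ∀ φ ∈ testClasses, ∀ f, ‖gaborL φ f‖ = ‖φ‖ * ‖f‖ := fun φ hφ f =>
    (isClosed_eq (f := fun f => ‖gaborL φ f‖) (g := fun f => ‖φ‖ * ‖f‖) (by fun_prop)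
      (by fun_prop)).closure_subset_iff.2 (h0 φ hφ) (dense_testClasses f)
  exact (isClosed_eq (f := fun φ => ‖gaborL φ f‖) (g := fun φ => ‖φ‖ * ‖f‖)
    ((gaborL.continuous.clm_apply continuous_const).norm) (by fun_prop)).closure_subset_iff.2
      (fun φ hφ => h1 φ hφ f) (dense_testClasses φ)

theorem inner_gaborL {φ : L2} (hφ : ‖φ‖ = 1) (f g : L2) :
    inner ℂ (gaborL φ f) (gaborL φ g) = inner ℂ f g :=
  LinearIsometry.inner_map_map (⟨(gaborL φ : L2 →ₗ[ℂ] PhaseL2), fun f => by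
    simp [norm_gaborL_apply, hφ]⟩ : L2 →ₗᵢ[ℂ] PhaseL2) f g

theorem integrable_mul_conj_shift {u v : ℝ → ℂ} (hu : HasCompactSupport u) (hu' : ContDiff ℝ ∞ u)
    (hv' : ContDiff ℝ ∞ v) (a b : ℝ) :
    Integrable fun t => u (t + a) * (starRingEnd ℂ) (v (t + b)) := by
  refine Continuous.integrable_of_hasCompactSupport ?_ ?_
  · exact (hu'.continuous.comp (by fun_prop)).mul
      (Complex.continuous_conj.comp (hv'.continuous.comp (by fun_prop)))
  · exact (hu.comp_homeomorph (Homeomorph.addRight a)).mul_right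

theorem hasDerivAt_mul_conj_shift {u v : ℝ → ℂ} (hu' : ContDiff ℝ ∞ u)
    (hv' : ContDiff ℝ ∞ v) (a b t : ℝ) :
    HasDerivAt (fun t => u (t + a) * (starRingEnd ℂ) (v (t + b)))
      (deriv u (t + a) * (starRingEnd ℂ) (v (t + b)) +
        u (t + a) * (starRingEnd ℂ) (deriv v (t + b))) t := by
  have h1 : HasDerivAt (fun t => u (t + a)) (deriv u (t + a)) t :=
    ((hu'.differentiable (by simp)).differentiableAt.hasDerivAt).comp_add_const t a
  have h2 : HasDerivAt (fun t => v (t + b)) (deriv v (t + b)) t :=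
    ((hv'.differentiable (by simp)).differentiableAt.hasDerivAt).comp_add_const t b
  have h3 : HasDerivAt (fun t => (starRingEnd ℂ) (v (t + b)))
      ((starRingEnd ℂ) (deriv v (t + b))) t := h2.star
  exact h1.mul h3

/-- Uniformly in the translations, the Fourier transform of `t ↦ u (t + a) * conj (v (t + b))`
decays faster than any power. -/
theorem exists_pow_mul_norm_fourier_le (k : ℕ) : ∀ {u v : ℝ → ℂ}, HasCompactSupport u →
    ContDiff ℝ ∞ u → HasCompactSupport v → ContDiff ℝ ∞ v → ∃ C : ℝ, ∀ a b s : ℝ,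
      |s| ^ k * ‖𝓕 (fun t => u (t + a) * (starRingEnd ℂ) (v (t + b))) s‖ ≤ C := by
  induction k with
  | zero =>
    intro u v hu hu' hv hv'
    obtain ⟨M, hM⟩ := hv.exists_bound_of_continuous hv'.continuous
    refine ⟨(∫ t, ‖u t‖) * M, fun a b s => ?_⟩
    rw [pow_zero, one_mul]
    have hi : Integrable u := hu'.continuous.integrable_of_hasCompactSupport hu
    calc _ ≤ ∫ t, ‖u (t + a) * (starRingEnd ℂ) (v (t + b))‖ :=
          VectorFourier.norm_fourierIntegral_le_integral_norm _ _ _ _ _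
      _ ≤ ∫ t, ‖u (t + a)‖ * M := by
          refine integral_mono (integrable_mul_conj_shift hu hu' hv' a b).norm
            ((hi.comp_add_right a).norm.mul_const M) fun t => ?_
          simp only [norm_mul, RCLike.norm_conj]
          exact mul_le_mul_of_nonneg_left (hM _) (norm_nonneg _)
      _ = _ := by
          rw [integral_mul_const, integral_add_right_eq_self (fun t => ‖u t‖) a]
  | succ k ih =>
    intro u v hu hu' hv hv'
    have du : ContDiff ℝ ∞ (deriv u) := (contDiff_infty_iff_deriv.1 hu').2
    have dv : ContDiff ℝ ∞ (deriv v) := (contDiff_infty_iff_deriv.1 hv').2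
    obtain ⟨C₁, h₁⟩ := ih hu.deriv du hv hv'
    obtain ⟨C₂, h₂⟩ := ih hu hu' hv.deriv dv
    refine ⟨C₁ + C₂, fun a b s => ?_⟩
    have i₁ := integrable_mul_conj_shift hu.deriv du hv' a b
    have i₂ := integrable_mul_conj_shift hu hu' dv a b
    have hd := hasDerivAt_mul_conj_shift hu' hv' a b
    have hderiv := funext fun t => (hd t).deriv
    have hF := congrFun (Real.fourier_deriv (integrable_mul_conj_shift hu hu' hv' a b)
      (fun t => (hd t).differentiableAt) (by rw [hderiv]; exact i₁.add i₂)) s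
    rw [hderiv] at hF
    have hsum : 𝓕 (fun t => deriv u (t + a) * (starRingEnd ℂ) (v (t + b)) +
        u (t + a) * (starRingEnd ℂ) (deriv v (t + b))) s
        = 𝓕 (fun t => deriv u (t + a) * (starRingEnd ℂ) (v (t + b))) s +
          𝓕 (fun t => u (t + a) * (starRingEnd ℂ) (deriv v (t + b))) s := by
      simp only [Real.fourier_eq, smul_add]
      exact integral_add ((Real.fourierIntegral_convergent_iff s).2 i₁)
        ((Real.fourierIntegral_convergent_iff s).2 i₂)
    rw [hsum] at hF
    set X := 𝓕 (fun t => u (t + a) * (starRingEnd ℂ) (v (t + b))) s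
    have hn : 2 * Real.pi * |s| * ‖X‖ ≤
        ‖𝓕 (fun t => deriv u (t + a) * (starRingEnd ℂ) (v (t + b))) s‖ +
        ‖𝓕 (fun t => u (t + a) * (starRingEnd ℂ) (deriv v (t + b))) s‖ := by
      refine le_trans (le_of_eq ?_) (norm_add_le _ _)
      rw [hF, norm_smul]
      simp [abs_of_pos Real.pi_pos]
    have hpi : |s| * ‖X‖ ≤ 2 * Real.pi * |s| * ‖X‖ := by
      have : 1 ≤ 2 * Real.pi := by linarith [Real.pi_gt_three]
      rw [mul_assoc]
      exact le_mul_of_one_le_left (by positivity) this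
    calc |s| ^ (k + 1) * ‖X‖ = |s| ^ k * (|s| * ‖X‖) := by ring
      _ ≤ |s| ^ k * (_ + _) := mul_le_mul_of_nonneg_left (hpi.trans hn) (by positivity)
      _ ≤ C₁ + C₂ := by rw [mul_add]; exact add_le_add (h₁ a b s) (h₂ a b s)

theorem norm_gabor_shift_eq {φ : L2} {p : ℝ → ℂ} (hp : φ =ᵐ[volume] p) (z w : ℝ × ℝ) :
    ‖gabor φ (shift z φ) w‖ =
      ‖𝓕 (fun t => p (t + z.1) * (starRingEnd ℂ) (p (t + w.1))) (w.2 - z.2)‖ := by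
  have h : shift z φ =ᵐ[volume] shiftFun z p := by
    filter_upwards [(memLp_shiftFun z φ).coeFn_toLp,
      (quasiMeasurePreserving_add_right volume z.1).ae hp] with t h1 h2
    rw [shift, h1, shiftFun, shiftFun, h2]
  rw [norm_gabor_eq_norm_fourier hp h]
  have : 𝓕 (fun t => shiftFun z p t * (starRingEnd ℂ) (p (t + w.1))) w.2
      = Complex.exp (((Real.pi * z.1 * z.2 : ℝ) : ℂ) * Complex.I) *
        𝓕 (fun t => p (t + z.1) * (starRingEnd ℂ) (p (t + w.1))) (w.2 - z.2) := by
    rw [Real.fourier_real_eq, Real.fourier_real_eq, ← integral_const_mul]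
    congr 1
    ext t
    simp only [shiftFun, Circle.smul_def, Real.fourierChar_apply, smul_eq_mul]
    rw [show ((2 * Real.pi * -(t * (w.2 - z.2)) : ℝ) : ℂ) * Complex.I
      = ((2 * Real.pi * -(t * w.2) : ℝ) : ℂ) * Complex.I + 2 * Real.pi * Complex.I * z.2 * t by
        push_cast; ring, Complex.exp_add,
      show (Real.pi * Complex.I * z.1 * z.2 : ℂ)
        = ((Real.pi * z.1 * z.2 : ℝ) : ℂ) * Complex.I by push_cast; ring]
    ring
  rw [this, norm_mul, Complex.norm_exp_ofReal_mul_I, one_mul]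

/-- The reproducing kernel of a smooth compactly supported window is dominated by an integrable
convolution kernel. -/
theorem exists_integrable_kernel_bound {φ : L2} (hφ : φ ∈ testClasses) :
    ∃ h : ℝ × ℝ → ℝ≥0∞, Measurable h ∧ ∫⁻ z, h z ≠ ⊤ ∧
      ∀ z w, ‖gabor φ (shift z φ) w‖ₑ ≤ h (z - w) := by
  obtain ⟨p, hp, hp1, hp2⟩ := hφ
  obtain ⟨C₀, h₀⟩ := exists_pow_mul_norm_fourier_le 0 hp1 hp2 hp1 hp2
  obtain ⟨C₂, h₂⟩ := exists_pow_mul_norm_fourier_le 2 hp1 hp2 hp1 hp2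
  obtain ⟨A, hA⟩ : ∃ A : ℝ, ∀ t, A < |t| → p t = 0 := by
    obtain ⟨A, hA⟩ := hp1.isCompact.isBounded.exists_norm_le
    refine ⟨A, fun t ht => image_eq_zero_of_notMem_tsupport fun hmem => ?_⟩
    exact absurd (hA t hmem) (not_le.2 ht)
  refine ⟨fun z => (Icc (-(2 * A)) (2 * A)).indicator 1 z.1 *
    ENNReal.ofReal ((C₀ + C₂) * (1 + z.2 ^ 2)⁻¹), ?_, ?_, fun z w => ?_⟩
  · refine Measurable.mul ?_ (by fun_prop)
    exact (measurable_one.indicator measurableSet_Icc).comp measurable_fst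
  · rw [Measure.volume_eq_prod, lintegral_prod_mul
      (f := (Icc (-(2 * A)) (2 * A)).indicator (1 : ℝ → ℝ≥0∞))
      (g := fun s : ℝ => ENNReal.ofReal ((C₀ + C₂) * (1 + s ^ 2)⁻¹))
      (measurable_one.indicator measurableSet_Icc).aemeasurable
      (by fun_prop)]
    refine ENNReal.mul_ne_top ?_ ?_
    · rw [lintegral_indicator_one measurableSet_Icc]
      simp
    · exact (integrable_inv_one_add_sq.const_mul (C₀ + C₂)).lintegral_lt_top.ne
  · rw [← ofReal_norm, norm_gabor_shift_eq hp]
    by_cases hz : z.1 - w.1 ∈ Icc (-(2 * A)) (2 * A)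
    · simp only [Prod.fst_sub, Prod.snd_sub, indicator_of_mem hz, Pi.one_apply, one_mul]
      refine ENNReal.ofReal_le_ofReal ?_
      have e0 := h₀ z.1 w.1 (w.2 - z.2)
      have e2 := h₂ z.1 w.1 (w.2 - z.2)
      rw [sq_abs] at e2
      rw [← div_eq_mul_inv, le_div_iff₀ (by positivity)]
      linarith
    · have : (fun t => p (t + z.1) * (starRingEnd ℂ) (p (t + w.1))) = fun _ => 0 := by
        ext t
        by_cases h1 : A < |t + z.1|
        · rw [hA _ h1, zero_mul]
        by_cases h3 : A < |t + w.1|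
        · rw [hA _ h3, map_zero, mul_zero]
        refine absurd ?_ hz
        rw [not_lt, abs_le] at h1 h3
        constructor <;> linarith
      rw [this, Real.fourier_real_eq]
      simp

theorem sq_lintegral_mul_le {α : Type*} [MeasurableSpace α] {μ : Measure α} {h W : α → ℝ≥0∞}
    (hh : AEMeasurable h μ) (hW : AEMeasurable W μ) :
    (∫⁻ x, h x * W x ∂μ) ^ 2 ≤ (∫⁻ x, h x ∂μ) * ∫⁻ x, h x * W x ^ 2 ∂μ := by
  have key := ENNReal.lintegral_mul_le_Lp_mul_Lq μ (p := 2) (q := 2)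
    (Real.holderConjugate_iff.2 ⟨by norm_num, by norm_num⟩)
    (f := fun x => h x ^ (1 / 2 : ℝ)) (g := fun x => h x ^ (1 / 2 : ℝ) * W x)
    (by fun_prop) (by fun_prop)
  have e1 : ∀ x, (h x ^ (1 / 2 : ℝ)) ^ (2 : ℝ) = h x := fun x => by
    rw [← ENNReal.rpow_mul]; norm_num
  have e2 : ∀ x, h x ^ (1 / 2 : ℝ) * (h x ^ (1 / 2 : ℝ) * W x) = h x * W x := fun x => by
    rw [← mul_assoc, ← ENNReal.rpow_add_of_nonneg _ _ (by norm_num) (by norm_num)]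
    norm_num
  have e3 : ∀ x, (h x ^ (1 / 2 : ℝ) * W x) ^ (2 : ℝ) = h x * W x ^ 2 := fun x => by
    rw [ENNReal.mul_rpow_of_nonneg _ _ (by norm_num), e1]
    norm_num
  simp only [Pi.mul_apply, e1, e2, e3] at key
  calc _ ≤ _ := pow_le_pow_left₀ zero_le key 2
    _ = _ := by
      rw [mul_pow, ← ENNReal.rpow_natCast, ← ENNReal.rpow_natCast, ← ENNReal.rpow_mul,
        ← ENNReal.rpow_mul]
      norm_num

/-- Young's inequality `‖h ∗ W‖₂ ≤ ‖h‖₁ ‖W‖₂`. -/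
theorem lintegral_sq_convolution_le {h W : ℝ × ℝ → ℝ≥0∞} (hh : Measurable h)
    (hW : Measurable W) :
    ∫⁻ z, (∫⁻ w, h (z - w) * W w) ^ 2 ≤ (∫⁻ z, h z) ^ 2 * ∫⁻ z, W z ^ 2 := by
  have hrefl : ∀ z : ℝ × ℝ, ∫⁻ w, h (z - w) = ∫⁻ w, h w := fun z => lintegral_sub_left_eq_self h z
  calc ∫⁻ z, (∫⁻ w, h (z - w) * W w) ^ 2
      ≤ ∫⁻ z, (∫⁻ w, h w) * ∫⁻ w, h (z - w) * W w ^ 2 := lintegral_mono fun z => by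
        rw [← hrefl z]
        exact sq_lintegral_mul_le (by fun_prop) hW.aemeasurable
    _ = (∫⁻ w, h w) * ∫⁻ w, ∫⁻ z, h (z - w) * W w ^ 2 := by
        rw [lintegral_const_mul, lintegral_lintegral_swap]
        · fun_prop
        · exact Measurable.lintegral_prod_right' (f := fun q : (ℝ × ℝ) × (ℝ × ℝ) =>
            h (q.1 - q.2) * W q.2 ^ 2) (by fun_prop)
    _ = (∫⁻ w, h w) * ∫⁻ w, (∫⁻ z, h z) * W w ^ 2 := by
        congr 2
        ext w
        rw [lintegral_mul_const _ (by fun_prop), lintegral_sub_right_eq_self h w]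
    _ = _ := by
        rw [lintegral_const_mul _ (by fun_prop)]
        ring

theorem exists_lintegral_tail_le {h : ℝ × ℝ → ℝ≥0∞} (hh : Measurable h) (hi : ∫⁻ z, h z ≠ ⊤)
    {ε : ℝ≥0∞} (hε : 0 < ε) :
    ∃ R : ℝ, 0 < R ∧ ∫⁻ z, {z | R ≤ ‖z‖}.indicator h z ≤ ε := by
  have ht : Tendsto (fun n : ℕ => ∫⁻ z, {z : ℝ × ℝ | (n : ℝ) ≤ ‖z‖}.indicator h z) atTop
      (𝓝 (∫⁻ _ : ℝ × ℝ, 0)) := by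
    refine tendsto_lintegral_of_dominated_convergence h (fun n => ?_)
      (fun n => Eventually.of_forall fun z => indicator_le_self _ _ _) hi
      (Eventually.of_forall fun z => ?_)
    · exact hh.indicator (measurableSet_le measurable_const measurable_norm)
    · refine tendsto_const_nhds.congr' ?_
      obtain ⟨N, hN⟩ := exists_nat_gt ‖z‖
      filter_upwards [eventually_ge_atTop N] with n hn
      rw [indicator_of_notMem]
      simp only [mem_ofPred_eq, not_le]
      exact hN.trans_le (by exact_mod_cast hn)
  rw [lintegral_zero] at ht
  obtain ⟨n, hn, hn'⟩ := ((ht.eventually (ge_mem_nhds hε)).and (eventually_gt_atTop 0)).exists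
  exact ⟨n, by exact_mod_cast hn', hn⟩

/-- The operator `S_φ S_φ^*` on `L²(ℝ²)`. -/
def frameOp (φ : L2) : PhaseL2 →L[ℂ] PhaseL2 :=
  (gaborL φ).comp (ContinuousLinearMap.adjoint (gaborL φ))

theorem gabor_adjoint_apply (φ : L2) (W : PhaseL2) (z : ℝ × ℝ) :
    gabor φ (ContinuousLinearMap.adjoint (gaborL φ) W) z =
      ∫ w, W w * (starRingEnd ℂ) (gabor φ (shift z φ) w) := by
  rw [gabor, ContinuousLinearMap.adjoint_inner_right, L2.inner_def]
  refine integral_congr_ae ?_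
  filter_upwards [coeFn_gaborLp φ (shift z φ)] with w hw
  rw [gaborL_apply, hw]
  simp

theorem exists_frameOp_offDiagonal_of_testClasses {φ : L2} (hφ : φ ∈ testClasses) {ε : ℝ≥0∞}
    (hε : 0 < ε) : ∃ R : ℝ, 0 < R ∧ ∀ E F : Set (ℝ × ℝ), MeasurableSet E →
      (∀ z ∈ E, ∀ w ∈ F, R ≤ dist z w) → ∀ W : PhaseL2, (∀ᵐ w, w ∉ F → W w = 0) →
        eLpNorm (frameOp φ W) 2 (volume.restrict E) ≤ ε * ‖W‖ₑ := by
  obtain ⟨h, hh, hi, hb⟩ := exists_integrable_kernel_bound hφ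
  obtain ⟨R, hR, htail⟩ := exists_lintegral_tail_le hh hi hε
  refine ⟨R, hR, fun E F hE hEF W hW => ?_⟩
  set k := {z : ℝ × ℝ | R ≤ ‖z‖}.indicator h
  have hk : Measurable k := hh.indicator (measurableSet_le measurable_const measurable_norm)
  have hWm : Measurable fun w => ‖W w‖ₑ := (Lp.stronglyMeasurable W).measurable.enorm
  have hpt : ∀ z ∈ E, ‖gabor φ (ContinuousLinearMap.adjoint (gaborL φ) W) z‖ₑ ≤
      ∫⁻ w, k (z - w) * ‖W w‖ₑ := by
    intro z hz
    rw [gabor_adjoint_apply]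
    refine (enorm_integral_le_lintegral_enorm _).trans (lintegral_mono_ae ?_)
    filter_upwards [hW] with w hw
    by_cases hwF : w ∈ F
    · have : z - w ∈ {z : ℝ × ℝ | R ≤ ‖z‖} := by
        rw [mem_ofPred_eq, ← dist_eq_norm]; exact hEF z hz w hwF
      rw [enorm_mul, RCLike.enorm_conj, mul_comm]
      simp only [k, indicator_of_mem this]
      exact mul_le_mul_left (hb z w) _
    · simp [hw hwF]
  have hsq : eLpNorm (frameOp φ W) 2 (volume.restrict E) ^ 2 ≤ (ε * ‖W‖ₑ) ^ 2 := by
    have e : eLpNorm (frameOp φ W) 2 (volume.restrict E) ^ 2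
        = ∫⁻ z in E, ‖gabor φ (ContinuousLinearMap.adjoint (gaborL φ) W) z‖ₑ ^ 2 := by
      rw [eLpNorm_eq_lintegral_rpow_enorm_toReal (by simp) (by simp), ← ENNReal.rpow_natCast,
        ← ENNReal.rpow_mul]
      simp only [ENNReal.toReal_ofNat, Nat.cast_ofNat, one_div, ENNReal.rpow_ofNat]
      norm_num
      refine lintegral_congr_ae (ae_restrict_of_ae ?_)
      filter_upwards [coeFn_gaborLp φ (ContinuousLinearMap.adjoint (gaborL φ) W)] with z hz
      rw [frameOp, ContinuousLinearMap.comp_apply, gaborL_apply, hz]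
    rw [e, mul_pow, enorm_sq_eq_lintegral W]
    calc _ ≤ ∫⁻ z in E, (∫⁻ w, k (z - w) * ‖W w‖ₑ) ^ 2 :=
          setLIntegral_mono' hE fun z hz => pow_le_pow_left₀ zero_le (hpt z hz) 2
      _ ≤ ∫⁻ z, (∫⁻ w, k (z - w) * ‖W w‖ₑ) ^ 2 := setLIntegral_le_lintegral _ _
      _ ≤ _ := lintegral_sq_convolution_le hk hWm
      _ ≤ _ := by gcongr
  exact (ENNReal.pow_le_pow_left_iff (by norm_num)).1 hsq

theorem norm_frameOp_sub_le (φ ψ : L2) :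
    ‖frameOp φ - frameOp ψ‖ ≤ (‖φ‖ + ‖ψ‖) * ‖φ - ψ‖ := by
  have e : frameOp φ - frameOp ψ = (gaborL φ).comp (ContinuousLinearMap.adjoint (gaborL (φ - ψ)))
      + (gaborL (φ - ψ)).comp (ContinuousLinearMap.adjoint (gaborL ψ)) := by
    ext1 W
    simp [frameOp, map_sub]
  rw [e]
  refine (norm_add_le _ _).trans ?_
  have adj : ∀ χ : L2, ‖ContinuousLinearMap.adjoint (gaborL χ)‖ ≤ ‖χ‖ := fun χ => by
    rw [LinearIsometryEquiv.norm_map]; exact norm_gaborL_le χ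
  have b1 : ‖(gaborL φ).comp (ContinuousLinearMap.adjoint (gaborL (φ - ψ)))‖ ≤ ‖φ‖ * ‖φ - ψ‖ :=
    (ContinuousLinearMap.opNorm_comp_le _ _).trans
      (mul_le_mul (norm_gaborL_le φ) (adj _) (norm_nonneg _) (norm_nonneg _))
  have b2 : ‖(gaborL (φ - ψ)).comp (ContinuousLinearMap.adjoint (gaborL ψ))‖ ≤ ‖φ - ψ‖ * ‖ψ‖ :=
    (ContinuousLinearMap.opNorm_comp_le _ _).trans
      (mul_le_mul (norm_gaborL_le _) (adj _) (norm_nonneg _) (norm_nonneg _))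
  linarith

/-- The operator `S_φ S_φ^*` has small norm between distant regions. -/
theorem exists_frameOp_offDiagonal (φ : L2) {ε : ℝ} (hε : 0 < ε) :
    ∃ R : ℝ, 0 < R ∧ ∀ E F : Set (ℝ × ℝ), MeasurableSet E →
      (∀ z ∈ E, ∀ w ∈ F, R ≤ dist z w) → ∀ W : PhaseL2, (∀ᵐ w, w ∉ F → W w = 0) →
        eLpNorm (frameOp φ W) 2 (volume.restrict E) ≤ ENNReal.ofReal ε * ‖W‖ₑ := by
  set δ : ℝ := min 1 (ε / (2 * (2 * ‖φ‖ + 1)))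
  have hδ : 0 < δ := lt_min one_pos (by positivity)
  obtain ⟨ψ, hψ, hd⟩ := dense_testClasses.exists_dist_lt φ hδ
  rw [dist_eq_norm] at hd
  obtain ⟨R, hR, hfar⟩ := exists_frameOp_offDiagonal_of_testClasses hψ
    (ε := ENNReal.ofReal (ε / 2)) (by simpa using hε)
  refine ⟨R, hR, fun E F hE hEF W hW => ?_⟩
  have hnorm : ‖frameOp φ - frameOp ψ‖ ≤ ε / 2 := by
    refine (norm_frameOp_sub_le φ ψ).trans ?_
    have h1 : ‖ψ‖ ≤ ‖φ‖ + 1 := by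
      have := norm_sub_norm_le ψ φ
      rw [norm_sub_rev] at this
      linarith [min_le_left (1 : ℝ) (ε / (2 * (2 * ‖φ‖ + 1)))]
    have h2 : ‖φ - ψ‖ ≤ ε / (2 * (2 * ‖φ‖ + 1)) := hd.le.trans (min_le_right _ _)
    calc _ ≤ (2 * ‖φ‖ + 1) * (ε / (2 * (2 * ‖φ‖ + 1))) :=
          mul_le_mul (by linarith) h2 (norm_nonneg _) (by positivity)
      _ = ε / 2 := by field_simp
  have hsplit : (frameOp φ W : ℝ × ℝ → ℂ) =ᵐ[volume.restrict E]
      ((frameOp φ - frameOp ψ) W : PhaseL2) + (frameOp ψ W : ℝ × ℝ → ℂ) := by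
    refine ae_restrict_of_ae ?_
    filter_upwards [Lp.coeFn_add ((frameOp φ - frameOp ψ) W) (frameOp ψ W)] with z hz
    rw [← hz]
    simp
  rw [eLpNorm_congr_ae hsplit]
  refine (eLpNorm_add_le (Lp.aestronglyMeasurable _).restrict (Lp.aestronglyMeasurable _).restrict
    (by norm_num)).trans ?_
  have h1 : eLpNorm ((frameOp φ - frameOp ψ) W) 2 (volume.restrict E) ≤
      ENNReal.ofReal (ε / 2) * ‖W‖ₑ := by
    refine (eLpNorm_restrict_le _ _ _ _).trans ?_
    rw [← Lp.enorm_def, ← ofReal_norm, ← ofReal_norm, ← ENNReal.ofReal_mul (by positivity)]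
    exact ENNReal.ofReal_le_ofReal ((ContinuousLinearMap.le_opNorm _ _).trans
      (mul_le_mul_of_nonneg_right hnorm (norm_nonneg _)))
  refine (add_le_add h1 (hfar E F hE hEF W hW)).trans (le_of_eq ?_)
  rw [← add_mul, ← ENNReal.ofReal_add (by positivity) (by positivity), add_halves]

theorem volume_le_of_horizontal_slices {S : Set (ℝ × ℝ)} (hS : MeasurableSet S) {x : ℝ × ℝ}
    {ρ D : ℝ} (hρ : 0 ≤ ρ) (hSx : S ⊆ Metric.ball x ρ)
    (h : ∀ a b y, (a, y) ∈ S → (b, y) ∈ S → |a - b| ≤ D) :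
    volume S ≤ ENNReal.ofReal (2 * ρ * D) := by
  have hslice : ∀ y, volume ((fun a => (a, y)) ⁻¹' S) ≤
      (Metric.ball x.2 ρ).indicator (fun _ => ENNReal.ofReal D) y := by
    intro y
    by_cases hy : y ∈ Metric.ball x.2 ρ
    · rw [indicator_of_mem hy]
      refine (Real.volume_le_diam _).trans (Metric.ediam_le fun a ha b hb => ?_)
      rw [edist_dist, Real.dist_eq]
      exact ENNReal.ofReal_le_ofReal (h a b y ha hb)
    · have : (fun a => (a, y)) ⁻¹' S = ∅ := by
        refine eq_empty_of_forall_notMem fun a ha => hy ?_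
        have := hSx ha
        rw [← ball_prod_same] at this
        exact this.2
      rw [this, measure_empty]
      exact zero_le
  rw [Measure.volume_eq_prod, Measure.prod_apply_symm hS]
  refine (lintegral_mono hslice).trans ?_
  rw [lintegral_indicator_const Metric.isOpen_ball.measurableSet, Real.volume_ball, mul_comm,
    ← ENNReal.ofReal_mul (by positivity)]

theorem volume_le_of_vertical_slices {S : Set (ℝ × ℝ)} (hS : MeasurableSet S) {x : ℝ × ℝ}
    {ρ D : ℝ} (hρ : 0 ≤ ρ) (hSx : S ⊆ Metric.ball x ρ)
    (h : ∀ a b y, (y, a) ∈ S → (y, b) ∈ S → |a - b| ≤ D) :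
    volume S ≤ ENNReal.ofReal (2 * ρ * D) := by
  have hm : MeasurePreserving (Prod.swap : ℝ × ℝ → ℝ × ℝ) volume volume :=
    Measure.measurePreserving_swap
  rw [← hm.measure_preimage hS.nullMeasurableSet]
  refine volume_le_of_horizontal_slices (x := x.swap) (measurable_swap hS) hρ (fun z hz => ?_)
    fun a b y ha hb => h a b y ha hb
  have := hSx hz
  rw [← ball_prod_same] at this ⊢
  exact ⟨this.2, this.1⟩

theorem mem_thickening_frontier {Ω : Set (ℝ × ℝ)} {ε : ℝ} {z : ℝ × ℝ} (hz : z ∈ Ω)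
    (h : z ∈ Metric.thickening ε Ωᶜ) : z ∈ Metric.thickening ε (frontier Ω) := by
  obtain ⟨w, hw, hd⟩ := Metric.mem_thickening_iff.1 h
  obtain ⟨y, hy, hyf⟩ : ∃ y ∈ segment ℝ z w, y ∈ frontier Ω := by
    by_contra! hcon
    have hnot : ∀ y ∈ segment ℝ z w, y ∈ closure Ω → y ∈ interior Ω := fun y hy hc => by
      by_contra hi
      exact hcon y hy ⟨hc, hi⟩
    obtain ⟨y, -, hyi, hyc⟩ := (convex_segment z w).isPreconnected (interior Ω) (closure Ω)ᶜ
      isOpen_interior isClosed_closure.isOpen_compl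
      (fun y hy => or_iff_not_imp_right.2 fun h => hnot y hy (not_not.1 h))
      ⟨z, left_mem_segment ℝ z w, hnot z (left_mem_segment ℝ z w) (subset_closure hz)⟩
      ⟨w, right_mem_segment ℝ z w, fun h =>
        hw (interior_subset (hnot w (right_mem_segment ℝ z w) h))⟩
    exact hyc (interior_subset_closure hyi)
  refine Metric.mem_thickening_iff.2 ⟨y, hyf, lt_of_le_of_lt ?_ hd⟩
  have := dist_add_dist_of_mem_segment hy
  linarith [dist_nonneg (x := y) (y := w)]

theorem IsBoundedC1Domain.exists_local_collar_bound {Ω : Set (ℝ × ℝ)} (hΩ : IsBoundedC1Domain Ω)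
    {x : ℝ × ℝ} (hx : x ∈ frontier Ω) :
    ∃ V, IsOpen V ∧ x ∈ V ∧ ∃ K : ℝ, ∀ᶠ ε in 𝓝[>] (0 : ℝ),
      volume (Ω ∩ V ∩ Metric.thickening ε Ωᶜ) ≤ ENNReal.ofReal (K * ε) := by
  obtain ⟨U, g, hU, hxU, hg, hg', hΩU⟩ := hΩ.boundary x hx
  set L := fderiv ℝ g x
  have hstrict : HasStrictFDerivAt g L x :=
    (hg.contDiffAt (hU.mem_nhds hxU)).hasStrictFDerivAt one_ne_zero
  have hcases : L (1, 0) ≠ 0 ∨ L (0, 1) ≠ 0 := by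
    by_contra! hcon
    refine hg' x hxU (ContinuousLinearMap.ext fun v => ?_)
    have : v = v.1 • ((1, 0) : ℝ × ℝ) + v.2 • ((0, 1) : ℝ × ℝ) := by ext <;> simp
    rw [this, map_add, map_smul, map_smul]
    change v.1 • L (1, 0) + v.2 • L (0, 1) = 0
    rw [hcon.1, hcon.2]; simp
  obtain ⟨e, he, hLe⟩ : ∃ e : ℝ × ℝ, (e = (1, 0) ∨ e = (0, 1)) ∧ L e ≠ 0 :=
    hcases.elim (fun h => ⟨_, Or.inl rfl, h⟩) (fun h => ⟨_, Or.inr rfl, h⟩)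
  have hnorm : ‖e‖ = 1 := by rcases he with rfl | rfl <;> simp [Prod.norm_def]
  set c := |L e|
  have hc : 0 < c := abs_pos.2 hLe
  obtain ⟨η, hη, hball⟩ : ∃ η > 0, ∀ a ∈ Metric.ball x η, ∀ b ∈ Metric.ball x η,
      a ∈ U ∧ |g a - g b - L (a - b)| ≤ c / 2 * ‖a - b‖ := by
    have h1 := hstrict.isLittleO.def (half_pos hc)
    have h2 : ∀ᶠ q : (ℝ × ℝ) × (ℝ × ℝ) in 𝓝 (x, x), q.1 ∈ U :=
      continuous_fst.continuousAt.eventually (hU.mem_nhds hxU)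
    obtain ⟨η, hη, h⟩ := Metric.eventually_nhds_iff_ball.1 (h2.and h1)
    refine ⟨η, hη, fun a ha b hb => ?_⟩
    have := h (a, b) (by rw [← ball_prod_same]; exact ⟨ha, hb⟩)
    exact this
  set M := ‖L‖ + c / 2
  have hcollar : ∀ ε < η / 2, ∀ z ∈ Ω ∩ Metric.ball x (η / 2) ∩ Metric.thickening ε Ωᶜ,
      g z < 0 ∧ -(M * ε) ≤ g z := by
    rintro ε hε z ⟨⟨hzΩ, hzx⟩, hzt⟩
    obtain ⟨w, hw, hd⟩ := Metric.mem_thickening_iff.1 hzt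
    have hzη : z ∈ Metric.ball x η := Metric.ball_subset_ball (by linarith) hzx
    have hwη : w ∈ Metric.ball x η := by
      rw [Metric.mem_ball] at hzx ⊢
      have := dist_triangle_left w x z
      linarith
    have hgz : g z < 0 := by
      have : z ∈ Ω ∩ U := ⟨hzΩ, (hball z hzη z hzη).1⟩
      rw [hΩU] at this
      exact this.2
    have hgw : 0 ≤ g w := by
      by_contra! hneg
      have : w ∈ {y ∈ U | g y < 0} := ⟨(hball w hwη w hwη).1, hneg⟩
      rw [← hΩU] at this
      exact hw this.1
    refine ⟨hgz, ?_⟩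
    have h1 := (abs_le.1 (hball z hzη w hwη).2).1
    have h2 := (abs_le.1 ((Real.norm_eq_abs _).symm.trans_le (L.le_opNorm (z - w)))).1
    rw [dist_eq_norm] at hd
    have h3 : M * ‖z - w‖ ≤ M * ε := mul_le_mul_of_nonneg_left hd.le (by positivity)
    have h4 : M * ‖z - w‖ = ‖L‖ * ‖z - w‖ + c / 2 * ‖z - w‖ := by ring
    linarith
  have hslice : ∀ ε < η / 2, ∀ z ∈ Ω ∩ Metric.ball x (η / 2) ∩ Metric.thickening ε Ωᶜ,
      ∀ z' ∈ Ω ∩ Metric.ball x (η / 2) ∩ Metric.thickening ε Ωᶜ, ∀ s : ℝ, z - z' = s • e →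
      |s| ≤ 2 * M / c * ε := by
    intro ε hε z hz z' hz' s hs
    have hb := (hball z (Metric.ball_subset_ball (by linarith) hz.1.2) z'
      (Metric.ball_subset_ball (by linarith) hz'.1.2)).2
    rw [hs, map_smul, norm_smul, hnorm, mul_one, smul_eq_mul, Real.norm_eq_abs] at hb
    have h1 := hcollar ε hε z hz
    have h2 := hcollar ε hε z' hz'
    have h3 : |g z - g z'| ≤ M * ε := abs_le.2 ⟨by linarith, by linarith⟩
    have h4 : |s| * c ≤ |g z - g z'| + |g z - g z' - s * L e| := by
      rw [← abs_mul]
      have := abs_sub (g z - g z') (g z - g z' - s * L e)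
      rwa [sub_sub_cancel] at this
    rw [div_mul_eq_mul_div, le_div_iff₀ hc]
    linarith
  refine ⟨Metric.ball x (η / 2), Metric.isOpen_ball, Metric.mem_ball_self (by linarith),
    2 * (η / 2) * (2 * M / c), ?_⟩
  filter_upwards [Ioo_mem_nhdsGT (half_pos hη)] with ε hε
  have hm : MeasurableSet (Ω ∩ Metric.ball x (η / 2) ∩ Metric.thickening ε Ωᶜ) :=
    ((hΩ.isOpen.inter Metric.isOpen_ball).inter Metric.isOpen_thickening).measurableSet
  rw [mul_assoc]
  rcases he with rfl | rfl
  · refine volume_le_of_horizontal_slices hm (by linarith) (fun z hz => hz.1.2)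
      fun a b y ha hb => hslice ε hε.2 _ ha _ hb (a - b) (by simp)
  · refine volume_le_of_vertical_slices hm (by linarith) (fun z hz => hz.1.2)
      fun a b y ha hb => hslice ε hε.2 _ ha _ hb (a - b) (by simp)

theorem IsBoundedC1Domain.exists_collar_bound {Ω : Set (ℝ × ℝ)} (hΩ : IsBoundedC1Domain Ω) :
    ∃ K : ℝ, 0 < K ∧ ∀ ε : ℝ, 0 < ε →
      volume (Ω ∩ Metric.thickening ε Ωᶜ) ≤ ENNReal.ofReal (K * ε) := by
  have hcomp : IsCompact (frontier Ω) :=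
    Metric.isCompact_of_isClosed_isBounded isClosed_frontier
      (hΩ.isBounded.closure.subset frontier_subset_closure)
  obtain ⟨V, hV, hΩV, K, hK⟩ : ∃ V, IsOpen V ∧ frontier Ω ⊆ V ∧ ∃ K : ℝ, ∀ᶠ ε in 𝓝[>] (0 : ℝ),
      volume (Ω ∩ V ∩ Metric.thickening ε Ωᶜ) ≤ ENNReal.ofReal (K * ε) := by
    refine hcomp.induction_on (p := fun s => ∃ V, IsOpen V ∧ s ⊆ V ∧ ∃ K : ℝ,
      ∀ᶠ ε in 𝓝[>] (0 : ℝ), volume (Ω ∩ V ∩ Metric.thickening ε Ωᶜ) ≤ ENNReal.ofReal (K * ε))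
      ⟨∅, isOpen_empty, Subset.rfl, 0, by simp⟩
      (fun s t hst ⟨V, hV, htV, h⟩ => ⟨V, hV, hst.trans htV, h⟩) ?_ ?_
    · rintro s t ⟨V, hV, hsV, K, hK⟩ ⟨V', hV', htV', K', hK'⟩
      refine ⟨V ∪ V', hV.union hV', union_subset_union hsV htV', |K| + |K'|, ?_⟩
      filter_upwards [hK, hK', self_mem_nhdsWithin] with ε h h' (hε : 0 < ε)
      have hsub : Ω ∩ (V ∪ V') ∩ Metric.thickening ε Ωᶜ ⊆
          (Ω ∩ V ∩ Metric.thickening ε Ωᶜ) ∪ (Ω ∩ V' ∩ Metric.thickening ε Ωᶜ) := by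
        rw [inter_union_distrib_left, union_inter_distrib_right]
      calc _ ≤ _ := (measure_mono hsub).trans (measure_union_le _ _)
        _ ≤ ENNReal.ofReal (|K| * ε) + ENNReal.ofReal (|K'| * ε) := by
            refine add_le_add (h.trans (ENNReal.ofReal_le_ofReal ?_))
              (h'.trans (ENNReal.ofReal_le_ofReal ?_))
            · exact mul_le_mul_of_nonneg_right (le_abs_self K) hε.le
            · exact mul_le_mul_of_nonneg_right (le_abs_self K') hε.le
        _ = _ := by rw [← ENNReal.ofReal_add (by positivity) (by positivity), add_mul]
    · intro x hx
      obtain ⟨V, hV, hxV, h⟩ := hΩ.exists_local_collar_bound hx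
      exact ⟨V, mem_nhdsWithin_of_mem_nhds (hV.mem_nhds hxV), V, hV, Subset.rfl, h⟩
  obtain ⟨δ, hδ, hδV⟩ := hcomp.exists_thickening_subset_open hV hΩV
  obtain ⟨ε₀, hε₀, h⟩ := mem_nhdsGT_iff_exists_Ioo_subset.1 (hK.and (Ioo_mem_nhdsGT hδ))
  have hε₀' : (0 : ℝ) < ε₀ := hε₀
  have hfin : volume Ω ≠ ⊤ := hΩ.isBounded.measure_lt_top.ne
  refine ⟨|K| + (volume.real Ω / ε₀ + 1), by positivity, fun ε hε => ?_⟩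
  by_cases hlt : ε < ε₀
  · obtain ⟨h1, h2⟩ := h ⟨hε, hlt⟩
    have hsub : Ω ∩ Metric.thickening ε Ωᶜ ⊆ Ω ∩ V ∩ Metric.thickening ε Ωᶜ := fun z hz =>
      ⟨⟨hz.1, hδV (Metric.thickening_mono h2.2.le _ (mem_thickening_frontier hz.1 hz.2))⟩, hz.2⟩
    refine (measure_mono hsub).trans (h1.trans (ENNReal.ofReal_le_ofReal ?_))
    refine mul_le_mul_of_nonneg_right ((le_abs_self K).trans ?_) hε.le
    have : 0 ≤ volume.real Ω / ε₀ := by positivity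
    linarith
  · refine (measure_mono inter_subset_left).trans ?_
    rw [← ofReal_measureReal hfin]
    refine ENNReal.ofReal_le_ofReal ?_
    rw [not_lt] at hlt
    calc volume.real Ω = volume.real Ω / ε₀ * ε₀ := by field_simp
      _ ≤ volume.real Ω / ε₀ * ε := mul_le_mul_of_nonneg_left hlt (by positivity)
      _ ≤ _ := mul_le_mul_of_nonneg_right (by linarith [abs_nonneg K]) hε.le

theorem dilate_eq_smul (r : ℝ) (Ω : Set (ℝ × ℝ)) : dilate r Ω = r • Ω := rfl

theorem dilate_inter_thickening_compl {r : ℝ} (hr : 0 < r) (Ω : Set (ℝ × ℝ)) (R : ℝ) :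
    dilate r Ω ∩ Metric.thickening R (dilate r Ω)ᶜ =
      r • (Ω ∩ Metric.thickening (R / r) Ωᶜ) := by
  rw [dilate_eq_smul]
  ext z
  simp only [mem_smul_set_iff_inv_smul_mem₀ hr.ne', mem_inter_iff, Metric.mem_thickening_iff,
    mem_compl_iff]
  refine and_congr_right fun _ => ⟨?_, ?_⟩
  · rintro ⟨w, hw, hd⟩
    refine ⟨r⁻¹ • w, hw, ?_⟩
    rw [dist_smul₀, Real.norm_of_nonneg (by positivity), inv_mul_eq_div]
    gcongr
  · rintro ⟨w, hw, hd⟩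
    refine ⟨r • w, by rwa [inv_smul_smul₀ hr.ne'], ?_⟩
    rw [lt_div_iff₀ hr] at hd
    have : dist z (r • w) = dist (r⁻¹ • z) w * r := by
      conv_lhs => rw [← smul_inv_smul₀ hr.ne' z]
      rw [dist_smul₀, Real.norm_of_nonneg hr.le, mul_comm]
    rwa [this]

theorem IsBoundedC1Domain.exists_dilate_collar_bound {Ω : Set (ℝ × ℝ)}
    (hΩ : IsBoundedC1Domain Ω) : ∃ K : ℝ, 0 < K ∧ ∀ r R : ℝ, 0 < r → 0 < R →
      volume (dilate r Ω ∩ Metric.thickening R (dilate r Ω)ᶜ) ≤ ENNReal.ofReal (K * R * r) := by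
  obtain ⟨K, hK, h⟩ := hΩ.exists_collar_bound
  refine ⟨K, hK, fun r R hr hR => ?_⟩
  rw [dilate_inter_thickening_compl hr, Measure.addHaar_smul]
  refine (mul_le_mul_right (h (R / r) (by positivity)) _).trans (le_of_eq ?_)
  rw [← ENNReal.ofReal_mul (by positivity), Module.finrank_prod, Module.finrank_self,
    abs_of_nonneg (by positivity)]
  congr 1
  field_simp

theorem isSymmetric_concentrationOp (φ : L2) {D : Set (ℝ × ℝ)} (hfin : volume D ≠ ⊤) :
    (concentrationOp φ D : L2 →ₗ[ℂ] L2).IsSymmetric := by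
  intro f g
  simp only [ContinuousLinearMap.coe_coe]
  rw [inner_concentrationOp φ D hfin, ← inner_conj_symm, inner_concentrationOp φ D hfin,
    energyForm, energyForm, ← integral_conj]
  congr 1
  ext z
  simp [inner_shift_eq, mul_comm]

theorem exists_orthonormal_of_le_rank {E : Type*} [NormedAddCommGroup E] [InnerProductSpace ℂ E]
    {n : ℕ} (h : (n : Cardinal) ≤ Module.rank ℂ E) : ∃ v : Fin n → E, Orthonormal ℂ v := by
  obtain ⟨v, hv⟩ := Module.le_rank_iff.1 h
  exact ⟨_, InnerProductSpace.gramSchmidtNormed_orthonormal hv⟩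

/-- The eigenvalue count of a symmetric operator is bounded by the sizes of its finite orthonormal
families of eigenvectors. -/
theorem eigenvalueCount_le {T : L2 →L[ℂ] L2} (hT : (T : L2 →ₗ[ℂ] L2).IsSymmetric) {a b : ℝ}
    {M : ℝ≥0∞} (h : ∀ (ι : Type) [Fintype ι] (f : ι → L2) (ν : ι → ℝ), Orthonormal ℂ f →
      (∀ i, ν i ∈ Icc a b) → (∀ i, T (f i) = (ν i : ℂ) • f i) → (Fintype.card ι : ℝ≥0∞) ≤ M) :
    eigenvalueCount T a b ≤ M := by
  by_cases hM : M = ⊤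
  · rw [hM]; exact le_top
  set V : Icc a b → Submodule ℂ L2 := fun ν =>
    Module.End.eigenspace (T : L2 →ₗ[ℂ] L2) ((ν : ℝ) : ℂ)
  have hinj : Function.Injective fun ν : Icc a b => ((ν : ℝ) : ℂ) :=
    Complex.ofReal_injective.comp Subtype.val_injective
  have hfam := hT.orthogonalFamily_eigenspaces.comp hinj
  have key : ∀ (s : Finset (Icc a b)) (n : Icc a b → ℕ),
      (∀ ν ∈ s, (n ν : Cardinal) ≤ Module.rank ℂ (V ν)) → ((∑ ν ∈ s, n ν : ℕ) : ℝ≥0∞) ≤ M := by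
    intro s n hn
    choose v hv using fun ν : s => exists_orthonormal_of_le_rank (hn ν.1 ν.2)
    have hort := (hfam.comp (Subtype.val_injective (p := (· ∈ s)))).orthonormal_sigma_orthonormal hv
    have := h (Σ ν : s, Fin (n ν.1)) _ (fun i => (i.1.1 : ℝ)) hort (fun i => i.1.1.2)
      fun i => Module.End.mem_eigenspace_iff.1 (v i.1 i.2).2
    rw [Fintype.card_sigma] at this
    simp only [Fintype.card_fin] at this
    rwa [Finset.sum_coe_sort s n] at this
  have hrank : ∀ ν, ∃ k : ℕ, Cardinal.toENat (Module.rank ℂ (V ν)) = k := by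
    intro ν
    obtain ⟨N, hN⟩ := ENNReal.exists_nat_gt hM
    have hlt : Cardinal.toENat (Module.rank ℂ (V ν)) ≠ ⊤ := by
      intro htop
      have hle : (N : Cardinal) ≤ Module.rank ℂ (V ν) := by
        rw [← Cardinal.natCast_le_toENat, htop]; exact le_top
      have := key {ν} (fun _ => N) (by simpa using hle)
      rw [Finset.sum_singleton] at this
      exact absurd this (not_le.2 hN)
    exact ⟨_, (ENat.natCast_toNat hlt).symm⟩
  choose k hk using hrank
  rw [eigenvalueCount, ENNReal.tsum_eq_iSup_sum]
  refine iSup_le fun s => ?_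
  have := key s k fun ν _ => by rw [← Cardinal.natCast_le_toENat, hk]
  refine le_trans (le_of_eq ?_) this
  push_cast
  refine Finset.sum_congr rfl fun ν _ => ?_
  exact (congrArg ((↑) : ℕ∞ → ℝ≥0∞) (hk ν).symm).symm

/-- The restriction of the Gabor transform to a region, as an element of `L²(ℝ²)`. -/
def gaborRestrict (φ f : L2) {F : Set (ℝ × ℝ)} (hF : MeasurableSet F) : PhaseL2 :=
  ((memLp_gabor φ f).indicator hF).toLp (F.indicator (gabor φ f))

theorem coeFn_gaborRestrict (φ f : L2) {F : Set (ℝ × ℝ)} (hF : MeasurableSet F) :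
    gaborRestrict φ f hF =ᵐ[volume] F.indicator (gabor φ f) :=
  ((memLp_gabor φ f).indicator hF).coeFn_toLp

theorem enorm_gaborRestrict_le (φ f : L2) {F : Set (ℝ × ℝ)} (hF : MeasurableSet F) :
    ‖gaborRestrict φ f hF‖ₑ ≤ ‖φ‖ₑ * ‖f‖ₑ := by
  refine (ENNReal.pow_le_pow_left_iff (n := 2) (by norm_num)).1 ?_
  rw [enorm_sq_eq_lintegral_of_ae_eq (coeFn_gaborRestrict φ f hF), mul_pow]
  refine (lintegral_mono fun z => ?_).trans (lintegral_gabor_sq_le φ f)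
  exact pow_le_pow_left₀ zero_le (enorm_indicator_le_enorm_self _ _) 2

theorem inner_adjoint_gaborRestrict (φ f g : L2) {F : Set (ℝ × ℝ)} (hF : MeasurableSet F) :
    inner ℂ g (ContinuousLinearMap.adjoint (gaborL φ) (gaborRestrict φ f hF)) =
      energyForm φ F f g := by
  rw [ContinuousLinearMap.adjoint_inner_right, L2.inner_def, energyForm, ← integral_indicator hF]
  refine integral_congr_ae ?_
  filter_upwards [coeFn_gaborLp φ g, coeFn_gaborRestrict φ f hF] with z h1 h2
  rw [gaborL_apply, h1, h2]
  by_cases hz : z ∈ F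
  · simp [hz, inner_shift_eq]
  · simp [hz]

theorem energyForm_univ {φ : L2} (hφ : ‖φ‖ = 1) (f g : L2) :
    energyForm φ univ f g = inner ℂ g f := by
  rw [← inner_gaborL hφ, ← inner_adjoint_gaborRestrict φ f g MeasurableSet.univ,
    ContinuousLinearMap.adjoint_inner_right]
  congr 1
  refine Lp.ext ?_
  filter_upwards [coeFn_gaborLp φ f, coeFn_gaborRestrict φ f MeasurableSet.univ] with z h1 h2
  rw [gaborL_apply, h1, h2, indicator_univ]

theorem integrable_energy (φ f g : L2) :
    Integrable fun z => gabor φ f z * inner ℂ g (shift z φ) := by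
  simp only [inner_shift_eq]
  exact (memLp_gabor φ f).integrable_mul (memLp_gabor φ g).star

theorem adjoint_gaborRestrict_compl {φ : L2} (hφ : ‖φ‖ = 1) {D : Set (ℝ × ℝ)}
    (hD : MeasurableSet D) (hfin : volume D ≠ ⊤) (f : L2) :
    ContinuousLinearMap.adjoint (gaborL φ) (gaborRestrict φ f hD.compl) =
      f - concentrationOp φ D f := by
  refine ext_inner_left ℂ fun g => ?_
  rw [inner_adjoint_gaborRestrict, inner_sub_right, inner_concentrationOp φ D hfin,
    ← energyForm_univ hφ, eq_sub_iff_add_eq', energyForm, energyForm, energyForm, setIntegral_univ]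
  exact integral_add_compl hD (integrable_energy φ f g)

theorem ofReal_le_lintegral_of_eigenvector {φ f : L2} {D : Set (ℝ × ℝ)}
    (hfin : volume D ≠ ⊤) (hf : ‖f‖ = 1) {ν : ℝ}
    (hν : concentrationOp φ D f = (ν : ℂ) • f) :
    ENNReal.ofReal ν ≤ ∫⁻ z in D, ‖gabor φ f z‖ₑ ^ 2 := by
  have h := inner_concentrationOp φ D hfin f f
  rw [hν, inner_smul_right, inner_self_eq_norm_sq_to_K, hf] at h
  have h' : (ν : ℂ) = energyForm φ D f f := by simpa using h
  calc ENNReal.ofReal ν ≤ ENNReal.ofReal ‖(ν : ℂ)‖ := ENNReal.ofReal_le_ofReal (by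
        rw [Complex.norm_real]; exact le_abs_self ν)
    _ = ‖energyForm φ D f f‖ₑ := by rw [ofReal_norm, h']
    _ ≤ ∫⁻ z in D, ‖gabor φ f z * inner ℂ f (shift z φ)‖ₑ := enorm_integral_le_lintegral_enorm _
    _ = _ := by
      refine lintegral_congr fun z => ?_
      rw [inner_shift_eq, enorm_mul, RCLike.enorm_conj, sq]

/-- An eigenvector whose eigenvalue stays away from `1` has little energy on the part of `D` where
the off-diagonal estimate applies. -/
theorem lintegral_far_le_of_eigenvector {φ f : L2} (hφ : ‖φ‖ = 1) {D E : Set (ℝ × ℝ)}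
    (hD : MeasurableSet D) (hfin : volume D ≠ ⊤) (hf : ‖f‖ = 1) {ν mu δ : ℝ}
    (hν : concentrationOp φ D f = (ν : ℂ) • f) (hνmu : ν ≤ mu) (hmu : mu < 1) (hδ : 0 ≤ δ)
    (hE : ∀ W : PhaseL2, (∀ᵐ w, w ∉ Dᶜ → W w = 0) →
      eLpNorm (frameOp φ W) 2 (volume.restrict E) ≤ ENNReal.ofReal ((1 - mu) * δ) * ‖W‖ₑ) :
    ∫⁻ z in E, ‖gabor φ f z‖ₑ ^ 2 ≤ ENNReal.ofReal (δ ^ 2) := by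
  set W := gaborRestrict φ f hD.compl
  have hW : ∀ᵐ w, w ∉ Dᶜ → W w = 0 := by
    filter_upwards [coeFn_gaborRestrict φ f hD.compl] with w hw hwD
    rw [hw, indicator_of_notMem hwD]
  have hframe : frameOp φ W = ((1 - ν : ℝ) : ℂ) • gaborLp φ f := by
    rw [frameOp, ContinuousLinearMap.comp_apply, adjoint_gaborRestrict_compl hφ hD hfin, hν,
      ← gaborL_apply, ← map_smul]
    congr 1
    push_cast
    rw [sub_smul, one_smul]
  have hW1 : ‖W‖ₑ ≤ 1 := by
    refine (enorm_gaborRestrict_le φ f hD.compl).trans ?_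
    rw [← ofReal_norm, ← ofReal_norm, hφ, hf]
    simp
  have hae : (((1 - ν : ℝ) : ℂ) • gaborLp φ f : PhaseL2) =ᵐ[volume.restrict E]
      ((1 - ν : ℝ) : ℂ) • gabor φ f := by
    refine ae_restrict_of_ae ?_
    filter_upwards [Lp.coeFn_smul ((1 - ν : ℝ) : ℂ) (gaborLp φ f), coeFn_gaborLp φ f] with z h1 h2
    rw [h1, Pi.smul_apply, Pi.smul_apply, h2]
  have hbound := hE W hW
  rw [hframe, eLpNorm_congr_ae hae, eLpNorm_const_smul] at hbound
  have hpos : 0 < 1 - mu := by linarith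
  have hcoef : ENNReal.ofReal (1 - mu) ≤ ‖((1 - ν : ℝ) : ℂ)‖ₑ := by
    rw [← ofReal_norm, Complex.norm_real]
    exact ENNReal.ofReal_le_ofReal (by linarith [Real.le_norm_self (1 - ν)])
  have hle : ENNReal.ofReal (1 - mu) * eLpNorm (gabor φ f) 2 (volume.restrict E) ≤
      ENNReal.ofReal (1 - mu) * ENNReal.ofReal δ := by
    rw [← ENNReal.ofReal_mul hpos.le]
    calc _ ≤ _ := mul_le_mul_left hcoef _
      _ ≤ _ := hbound
      _ ≤ _ := mul_le_mul_right hW1 _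
      _ = _ := mul_one _
  have hsmall : eLpNorm (gabor φ f) 2 (volume.restrict E) ≤ ENNReal.ofReal δ :=
    (ENNReal.mul_le_mul_iff_right (by simpa using hpos) ENNReal.ofReal_ne_top).1 hle
  have := pow_le_pow_left₀ zero_le hsmall 2
  rw [eLpNorm_eq_lintegral_rpow_enorm_toReal (by simp) (by simp), ← ENNReal.rpow_natCast,
    ← ENNReal.rpow_mul, ← ENNReal.ofReal_pow hδ] at this
  simpa using this

theorem sum_enorm_gabor_sq_le {φ : L2} (hφ : ‖φ‖ = 1) {ι : Type*} [Fintype ι] {f : ι → L2}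
    (hf : Orthonormal ℂ f) (z : ℝ × ℝ) : ∑ i, ‖gabor φ (f i) z‖ₑ ^ 2 ≤ 1 := by
  have h := hf.sum_inner_products_le (shift z φ) (s := Finset.univ)
  rw [norm_shift, hφ, one_pow] at h
  have e : ∀ i, ‖gabor φ (f i) z‖ₑ ^ 2 = ENNReal.ofReal (‖inner ℂ (f i) (shift z φ)‖ ^ 2) := by
    intro i
    rw [inner_shift_eq, RCLike.norm_conj, ENNReal.ofReal_pow (norm_nonneg _), ofReal_norm]
  simp only [e]
  rw [← ENNReal.ofReal_sum_of_nonneg fun i _ => by positivity]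
  simpa using ENNReal.ofReal_le_ofReal h

theorem exists_eigenvalueCount_le_collar {φ : L2} (hφ : ‖φ‖ = 1) {lam mu : ℝ} (hlam : 0 < lam)
    (hmu : mu < 1) : ∃ R : ℝ, 0 < R ∧ ∀ D : Set (ℝ × ℝ), MeasurableSet D → volume D ≠ ⊤ →
      eigenvalueCount (concentrationOp φ D) lam mu ≤
        volume (D ∩ Metric.thickening R Dᶜ) / ENNReal.ofReal (lam / 2) := by
  have hpos : 0 < 1 - mu := by linarith
  obtain ⟨R, hR, hfar⟩ := exists_frameOp_offDiagonal φ
    (ε := (1 - mu) * Real.sqrt (lam / 2)) (by positivity)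
  refine ⟨R, hR, fun D hD hfin => eigenvalueCount_le (isSymmetric_concentrationOp φ hfin) ?_⟩
  intro ι _ f ν hf hν hT
  set N := D ∩ Metric.thickening R Dᶜ
  set E := D \ Metric.thickening R Dᶜ
  have hE : MeasurableSet E := hD.diff Metric.isOpen_thickening.measurableSet
  have hEF : ∀ z ∈ E, ∀ w ∈ Dᶜ, R ≤ dist z w := by
    intro z hz w hw
    by_contra! hlt
    exact hz.2 (Metric.mem_thickening_iff.2 ⟨w, hw, hlt⟩)
  have hnear : ∀ i, ENNReal.ofReal (lam / 2) ≤ ∫⁻ z in N, ‖gabor φ (f i) z‖ₑ ^ 2 := by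
    intro i
    have h1 := lintegral_far_le_of_eigenvector hφ hD hfin (hf.1 i) (hT i) (hν i).2 hmu
      (Real.sqrt_nonneg (lam / 2)) (hfar E Dᶜ hE hEF)
    rw [Real.sq_sqrt (by positivity)] at h1
    have h2 := ofReal_le_lintegral_of_eigenvector hfin (hf.1 i) (hT i)
    have h3 : ∫⁻ z in D, ‖gabor φ (f i) z‖ₑ ^ 2 ≤
        (∫⁻ z in N, ‖gabor φ (f i) z‖ₑ ^ 2) + ∫⁻ z in E, ‖gabor φ (f i) z‖ₑ ^ 2 := by
      rw [← inter_union_sdiff D (Metric.thickening R Dᶜ)]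
      exact lintegral_union_le _ _ _
    have h4 : ENNReal.ofReal (lam / 2) + ENNReal.ofReal (lam / 2) ≤
        (∫⁻ z in N, ‖gabor φ (f i) z‖ₑ ^ 2) + ENNReal.ofReal (lam / 2) := by
      rw [← ENNReal.ofReal_add (by positivity) (by positivity), add_halves]
      exact (ENNReal.ofReal_le_ofReal (hν i).1).trans (h2.trans (h3.trans (by gcongr)))
    exact (ENNReal.add_le_add_iff_right ENNReal.ofReal_ne_top).1 h4
  rw [ENNReal.le_div_iff_mul_le (Or.inl (by simpa using hlam)) (Or.inl ENNReal.ofReal_ne_top)]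
  calc (Fintype.card ι : ℝ≥0∞) * ENNReal.ofReal (lam / 2)
      = ∑ _i : ι, ENNReal.ofReal (lam / 2) := by simp
    _ ≤ ∑ i, ∫⁻ z in N, ‖gabor φ (f i) z‖ₑ ^ 2 := Finset.sum_le_sum fun i _ => hnear i
    _ = ∫⁻ z in N, ∑ i, ‖gabor φ (f i) z‖ₑ ^ 2 :=
        (lintegral_finsetSum _ fun i _ => measurable_enorm_gabor_sq φ (f i)).symm
    _ ≤ ∫⁻ _ in N, 1 := lintegral_mono fun z => sum_enorm_gabor_sq_le hφ hf z
    _ = volume N := setLIntegral_one N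

end Gabor
end

/-- The number of eigenvalues in `[lam, mu]` grows at most linearly in the dilation factor. The decay
hypothesis is not needed: `S_φ S_φ^*` is an operator-norm limit of operators with integrable
convolution-dominated kernels, so its off-diagonal blocks become small for every window in `L²`. -/
theorem mainTheorem2 (φ : Gabor.L2) (hφ : ‖φ‖ = 1) (Ω : Set (ℝ × ℝ))
    (hΩ : Gabor.IsBoundedC1Domain Ω)
    (hdecay : Gabor.TailDecay (fun z => ‖Gabor.gabor φ φ z‖ ^ 2))
    (lam mu : ℝ) (hlam : 0 < lam) (hlm : lam < mu) (hmu : mu < 1) :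
    ∃ C : ℝ, 0 < C ∧ ∀ r : ℝ, 0 < r →
      Gabor.eigenvalueCount (Gabor.concentrationOp φ (Gabor.dilate r Ω)) lam mu
        ≤ ENNReal.ofReal (C * r) := by
  obtain ⟨R, hR, hcount⟩ := Gabor.exists_eigenvalueCount_le_collar hφ hlam hmu
  obtain ⟨K, hK, hcollar⟩ := hΩ.exists_dilate_collar_bound
  refine ⟨K * R / (lam / 2), by positivity, fun r hr => ?_⟩
  have hopen : IsOpen (Gabor.dilate r Ω) := hΩ.isOpen.smul₀ hr.ne'
  have hfin : volume (Gabor.dilate r Ω) ≠ ⊤ := (hΩ.isBounded.smul₀ r).measure_lt_top.ne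
  calc _ ≤ _ := hcount _ hopen.measurableSet hfin
    _ ≤ ENNReal.ofReal (K * R * r) / ENNReal.ofReal (lam / 2) :=
        ENNReal.div_le_div_right (hcollar r R hr hR) _
    _ = _ := by
      rw [← ENNReal.ofReal_div_of_pos (by positivity)]
      congr 1
      ring
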